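/- **Conventions.** For integers $1\le t\le k\le v$ and $\lambda\ge 1$, a $t$-$(v,k,\lambda)$ design is a pair $(X,\mathcal B)$ of a set $X$ with $v$ points and a family $\mathcal B$ of distinct $k$-subsets (blocks) of $X$ such that every $t$-subset of $X$ lies in exactly $\lambda$ blocks. For a finite abelian group $A$, let $\mathcal B_k$ be the family of all $k$-subsets of $A$ whose elements sum to $0$. For a linear code $C\subseteq\mathbb F_q^n$ with minimum distance $d$, let $\mathcal H_d(C)$ be the set of supports $\{i: c_i\ne 0\}\subseteq\{1,\dots,n\}$ of the codewords $c\in C$ of Hamming weight $d$; the minimum-weight codewords of $C$ *support a $t$-design* if $(\{1,\dots,n\},\mathcal H_d(C))$ is a $t$-$(n,d,\lambda)$ design for some $\lambda$. **Theorem.** Let $E$ be an elliptic curve over the finite field $\mathbb F_q$, with point at infinity $O$ as the zero of its group, and suppose $E(\mathbb F_q)\cong \mathbb Z_{n_1}\oplus\mathbb Z_{n_2}$ with $1<n_1\mid n_2$. Put $n=n_1n_2-1$, let $P_1,\dots,P_n$ be the distinct points of $E(\mathbb F_q)\setminus\{O\}$, let $1\le k\le n-1$, $D=P_1+\cdots+P_n$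 and $G=kO$. Let $$C_{\mathscr L}(D,G)=\{(f(P_1),\dots,f(P_n)) : f\in\mathscr L(G)\}\subseteq\mathbb F_q^n,\qquad \mathscr L(G)=\{f\in\mathbb F_q(E)^\times : \operatorname{div}(f)\ge -G\}\cup\{0\}.$$ Let $t\ge 1$. If $n_2\mid k$ and $(\mathbb Z_{n_1}\oplus\mathbb Z_{n_2},\mathcal B_k)$ is a $(t+1)$-$(n+1,k,\lambda_{t+1})$ design for some $\lambda_{t+1}$, then $C_{\mathscr L}(D,G)$ is an $[n,k,n-k]$ code (it has dimension $k$ and minimum distance $n-k$), and its minimum-weight codewords support a $t$-design: $(\{1,\dots,n\},\mathcal H_{n-k}(C_{\mathscr L}(D,G)))$ is a $t$-$(n,n-k,\lambda_t)$ design for some $\lambda_t$. -/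

import Mathlib

open Polynomial
open scoped Polynomial.Bivariate

namespace EllipticCode

/-! ### Designs -/

/-- The family `blocks` of (distinct) finite subsets of the point set `α` is a
`t`-`(v, k, lam)` design, where `v = |α|`: every block has exactly `k` points, and every
`t`-subset of `α` lies in exactly `lam` blocks. As usual `t ≤ k ≤ v` and `lam` is positive. -/
structure IsDesign {α : Type*} (t v k lam : ℕ) (blocks : Set (Finset α)) : Prop where
  card_points : Nat.card α = v
  finite_points : Finite α
  t_le_k : t ≤ k
  k_le_v : k ≤ v
  lam_pos : 0 < lam
  card_block : ∀ B ∈ blocks, B.card = k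
  card_blocks_containing : ∀ T : Finset α, T.card = t → {B ∈ blocks | T ⊆ B}.ncard = lam

/-- The family of all `k`-subsets of an abelian group summing to `x`. -/
def subsetSumBlocks (G : Type*) [AddCommGroup G] (k : ℕ) (x : G) : Set (Finset G) :=
  {B | B.card = k ∧ ∑ g ∈ B, g = x}

/-! ### Linear codes -/

section Codes

variable {F : Type*} [Field F] [DecidableEq F] {n : ℕ}

/-- `d` is the minimum distance of the linear code `C`. -/
def IsMinDistance (C : Submodule F (Fin n → F)) (d : ℕ) : Prop :=
  IsLeast {w | ∃ c ∈ C, c ≠ 0 ∧ hammingNorm c = w} d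

/-- The support of a word. -/
def wordSupport (c : Fin n → F) : Finset (Fin n) := {i | c i ≠ 0}

/-- The set of the supports of all codewords of Hamming weight `d`. -/
def weightSupports (C : Submodule F (Fin n → F)) (d : ℕ) : Set (Finset (Fin n)) :=
  {S | ∃ c ∈ C, hammingNorm c = d ∧ wordSupport c = S}

end Codes

/-! ### Functions on a Weierstrass curve

`W` is a Weierstrass curve over `F`, with function field `W.FunctionField` over `F`. Geometric
points are points over the algebraic closure of `F`. Near an affine point we use the
coordinates `(x, y)`; near the point at infinity `O = [0 : 1 : 0]` we use the affine chart
`(x / y, 1 / y)` of the projective plane, in which `O` is the origin. -/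

noncomputable section

universe u

variable {F : Type u} [Field F] (W : WeierstrassCurve.Affine F)

/-- Points of the curve over the algebraic closure of the base field. -/
abbrev GeomPoint : Type u :=
  (WeierstrassCurve.map W (algebraMap F (AlgebraicClosure F))).toAffine.Point

/-- A rational point, seen as a geometric point. -/
def toGeom : W.Point → GeomPoint W
  | .zero => .zero
  | .some a b h => .some (algebraMap F (AlgebraicClosure F) a) (algebraMap F (AlgebraicClosure F) b)
      ((WeierstrassCurve.Affine.map_nonsingular W
        (algebraMap F (AlgebraicClosure F)).injective a b).mpr h)

/-- The coordinate function `x`. -/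
def xFun : W.FunctionField :=
  algebraMap W.CoordinateRing W.FunctionField (WeierstrassCurve.Affine.CoordinateRing.mk W (C X))

/-- The coordinate function `y`. -/
def yFun : W.FunctionField :=
  algebraMap W.CoordinateRing W.FunctionField (WeierstrassCurve.Affine.CoordinateRing.mk W Y)

variable {W}

/-- The two coordinate functions of the affine chart used around `Q`. -/
def chartFun : GeomPoint W → W.FunctionField × W.FunctionField
  | .zero => (xFun W / yFun W, 1 / yFun W)
  | .some _ _ _ => (xFun W, yFun W)

/-- The coordinates of `Q` in the affine chart used around `Q`. -/
def chartCoord : GeomPoint W → AlgebraicClosure F × AlgebraicClosure F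
  | .zero => (0, 0)
  | .some a b _ => (a, b)

/-- A polynomial in the coordinates of the chart around `Q`, as a function on the curve. -/
abbrev polyFun (Q : GeomPoint W) : F[X][Y] →ₐ[F] W.FunctionField :=
  aevalAeval (chartFun Q).1 (chartFun Q).2

/-- The value at `Q` of a polynomial in the coordinates of the chart around `Q`. -/
abbrev polyVal (Q : GeomPoint W) : F[X][Y] →ₐ[F] AlgebraicClosure F :=
  aevalAeval (chartCoord Q).1 (chartCoord Q).2

/-- `f = g / h` with `g`, `h` polynomials over `F` in the coordinates of the chart around `Q` and
`h(Q) ≠ 0`. (Then `h` is also nonzero as a function on the curve.) -/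
def IsFractionAt (Q : GeomPoint W) (f : W.FunctionField) (g h : F[X][Y]) : Prop :=
  polyVal Q h ≠ 0 ∧ f * polyFun Q h = polyFun Q g

lemma IsFractionAt.add {Q : GeomPoint W} {f₁ f₂ : W.FunctionField} {g₁ h₁ g₂ h₂ : F[X][Y]}
    (H₁ : IsFractionAt Q f₁ g₁ h₁) (H₂ : IsFractionAt Q f₂ g₂ h₂) :
    IsFractionAt Q (f₁ + f₂) (g₁ * h₂ + g₂ * h₁) (h₁ * h₂) := by
  refine ⟨by rw [map_mul]; exact mul_ne_zero H₁.1 H₂.1, ?_⟩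
  rw [map_add, map_mul, map_mul, map_mul, ← H₁.2, ← H₂.2]
  ring

lemma IsFractionAt.mul {Q : GeomPoint W} {f₁ f₂ : W.FunctionField} {g₁ h₁ g₂ h₂ : F[X][Y]}
    (H₁ : IsFractionAt Q f₁ g₁ h₁) (H₂ : IsFractionAt Q f₂ g₂ h₂) :
    IsFractionAt Q (f₁ * f₂) (g₁ * g₂) (h₁ * h₂) := by
  refine ⟨by rw [map_mul]; exact mul_ne_zero H₁.1 H₂.1, ?_⟩
  rw [map_mul, map_mul, ← H₁.2, ← H₂.2]
  ring

lemma IsFractionAt.neg {Q : GeomPoint W} {f : W.FunctionField} {g h : F[X][Y]}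
    (H : IsFractionAt Q f g h) : IsFractionAt Q (-f) (-g) h :=
  ⟨H.1, by rw [map_neg, ← H.2, neg_mul]⟩

lemma isFractionAt_poly (Q : GeomPoint W) (g : F[X][Y]) : IsFractionAt Q (polyFun Q g) g 1 :=
  ⟨by rw [map_one]; exact one_ne_zero, by rw [map_one, mul_one]⟩

lemma isFractionAt_zero (Q : GeomPoint W) : IsFractionAt Q 0 0 1 := by
  simpa using isFractionAt_poly Q 0

lemma isFractionAt_one (Q : GeomPoint W) : IsFractionAt Q 1 1 1 := by
  simpa using isFractionAt_poly Q 1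

lemma isFractionAt_algebraMap (Q : GeomPoint W) (c : F) :
    IsFractionAt Q (algebraMap F W.FunctionField c) (algebraMap F F[X][Y] c) 1 := by
  simpa only [AlgHom.commutes] using isFractionAt_poly Q (algebraMap F F[X][Y] c)

/-- The local ring at `Q`: the rational functions over `F` that are regular at `Q`. -/
def localRing (Q : GeomPoint W) : Subring W.FunctionField where
  carrier := {f | ∃ g h, IsFractionAt Q f g h}
  zero_mem' := ⟨_, _, isFractionAt_zero Q⟩
  one_mem' := ⟨_, _, isFractionAt_one Q⟩
  add_mem' := fun ⟨_, _, H₁⟩ ⟨_, _, H₂⟩ => ⟨_, _, H₁.add H₂⟩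
  mul_mem' := fun ⟨_, _, H₁⟩ ⟨_, _, H₂⟩ => ⟨_, _, H₁.mul H₂⟩
  neg_mem' := fun ⟨_, _, H⟩ => ⟨_, _, H.neg⟩

/-- The maximal ideal of the local ring at `Q`: the regular functions that vanish at `Q`. -/
def maxIdeal (Q : GeomPoint W) : Ideal (localRing Q) where
  carrier := {f | ∃ g h, IsFractionAt Q f g h ∧ polyVal Q g = 0}
  zero_mem' := ⟨_, _, isFractionAt_zero Q, map_zero _⟩
  add_mem' := fun ⟨_, _, H₁, e₁⟩ ⟨_, _, H₂, e₂⟩ =>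
    ⟨_, _, H₁.add H₂, by rw [map_add, map_mul, map_mul, e₁, e₂, zero_mul, zero_mul, add_zero]⟩
  smul_mem' := fun c _ ⟨_, _, H, e⟩ => by
    obtain ⟨_, _, H'⟩ := c.2
    exact ⟨_, _, H'.mul H, by rw [map_mul, e, mul_zero]⟩

/-- `v_Q(f) ≥ m`, where `v_Q` is the valuation of the local ring at `Q` (with `v_Q(0) = ∞`). In
terms of the maximal ideal `𝔪` of the local ring: `f ∈ 𝔪 ^ m` if `m ≥ 0`, and `f 𝔪 ^ (-m)` is
contained in the local ring if `m ≤ 0`; both cases are covered by `f 𝔪 ^ m⁻ ⊆ 𝔪 ^ m⁺`. -/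
def ValGE (Q : GeomPoint W) (m : ℤ) (f : W.FunctionField) : Prop :=
  ∀ g ∈ maxIdeal Q ^ (-m).toNat, ∃ r ∈ maxIdeal Q ^ m.toNat, f * g = r

/-- The Riemann–Roch space `𝓛(G)`: zero and all nonzero `f ∈ F(W)` with `div(f) ≥ -G`, that is
`v_Q(f) ≥ -G(Q)` at all geometric points `Q`. -/
def riemannRochSpace (G : GeomPoint W →₀ ℤ) : Submodule F W.FunctionField where
  carrier := {f | ∀ Q, ValGE Q (-G Q) f}
  zero_mem' := fun Q g _ => ⟨0, zero_mem _, by simp⟩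
  add_mem' := fun {f₁ f₂} H₁ H₂ Q g hg => by
    obtain ⟨r₁, hr₁, e₁⟩ := H₁ Q g hg
    obtain ⟨r₂, hr₂, e₂⟩ := H₂ Q g hg
    exact ⟨r₁ + r₂, add_mem hr₁ hr₂, by rw [add_mul, e₁, e₂]; rfl⟩
  smul_mem' := fun c f H Q g hg => by
    obtain ⟨r, hr, e⟩ := H Q g hg
    refine ⟨⟨algebraMap F W.FunctionField c, _, _, isFractionAt_algebraMap Q c⟩ * r,
      Ideal.mul_mem_left _ _ hr, ?_⟩
    rw [Algebra.smul_def, mul_assoc, e]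
    rfl

/-- The function `f` is regular at the rational point `P`, with value `f(P) = c`. -/
def HasValue (f : W.FunctionField) (P : W.Point) (c : F) : Prop :=
  ∃ g h, IsFractionAt (toGeom W P) f g h ∧
    algebraMap F (AlgebraicClosure F) c * polyVal (toGeom W P) h = polyVal (toGeom W P) g

/-- The algebraic geometry code `C_𝓛(D, G)`, with `D = P 0 + ⋯ + P (n - 1)`: the set of all
`(f(P 0), …, f(P (n - 1)))` with `f ∈ 𝓛(G)`. -/
def agCode {n : ℕ} (P : Fin n → W.Point) (G : GeomPoint W →₀ ℤ) : Submodule F (Fin n → F) where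
  carrier := {c | ∃ f ∈ riemannRochSpace G, ∀ i, HasValue f (P i) (c i)}
  zero_mem' := ⟨0, zero_mem _, fun i => ⟨0, 1, isFractionAt_zero _, by simp⟩⟩
  add_mem' := by
    rintro c₁ c₂ ⟨f₁, hf₁, H₁⟩ ⟨f₂, hf₂, H₂⟩
    refine ⟨f₁ + f₂, add_mem hf₁ hf₂, fun i => ?_⟩
    obtain ⟨g₁, h₁, E₁, e₁⟩ := H₁ i
    obtain ⟨g₂, h₂, E₂, e₂⟩ := H₂ i
    refine ⟨_, _, E₁.add E₂, ?_⟩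
    rw [Pi.add_apply, map_add, map_add, map_mul, map_mul, map_mul, ← e₁, ← e₂]
    ring
  smul_mem' := by
    rintro a c ⟨f, hf, H⟩
    refine ⟨a • f, Submodule.smul_mem _ a hf, fun i => ?_⟩
    obtain ⟨g, h, E, e⟩ := H i
    refine ⟨_, _, by rw [Algebra.smul_def]; exact (isFractionAt_algebraMap _ a).mul E, ?_⟩
    rw [Pi.smul_apply, smul_eq_mul, map_mul, map_mul, map_mul, map_one, one_mul, ← e,
      AlgHom.commutes, mul_assoc]

end

end EllipticCode

/-! Let `R` be the affine coordinate ring. It is free over `F[X]` with basis `1, y`, and the norm of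
`p + q y` has degree `max (2 deg p) (2 deg q + 3)`, the pole order at `O`. So the functions in
`𝓛(kO)` are exactly the `r ∈ R` whose norm has degree at most `k`
(`mem_riemannRochSpace_single_iff`), and counting coefficients of `p` and `q` gives dimension `k`;
evaluation is injective since `k < n`.

The norm degree of `r ≠ 0` is also `dim R/(r)`, which bounds the number of rational zeros. Hence
nonzero words have weight at least `n - k`, with equality iff `r` vanishes at exactly `k` of the
points. Then `(r)` is the product of their maximal ideals, and by injectivity of the map from points
to the class group such an `r` exists iff the `k` points sum to zero. So the supports of weight `n -
k` are the complements of the zero-sum `k`-sets of nonzero points (`mem_weightSupports_agCode_iff`).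

Such a support contains a `t`-set `T` iff the zero-sum set misses the `(t + 1)`-set `T ∪ {O}`. In a
`(t + 1)`-design the number of blocks missing a `(t + 1)`-set is constant, by inclusion-exclusion.
It is positive because `t + 1 + k ≤ n + 1`: otherwise every `k`-set would be a block, which is false
for zero-sum sets. Positivity also shows that the weight `n - k` is attained. -/

namespace EllipticCode

/-! ### Block counts in designs -/

section Designs

variable {α : Type*} {s v k lam : ℕ} {B : Set (Finset α)}

/-- Descending induction on `i`: counting pairs `(x, b)` with `x ∉ I` and `I ∪ {x} ⊆ b` in two ways
gives `(v - i) λ_{i+1} = λ_i (k - i)`. The division is exact and legitimate because `i < s ≤ k`. -/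
lemma IsDesign.ncard_containing_eq [Fintype α] [DecidableEq α] (h : IsDesign s v k lam B) (d : ℕ) :
    ∀ i, i + d = s → ∃ c, ∀ I : Finset α, I.card = i → {b ∈ B | I ⊆ b}.ncard = c := by
  classical
  induction d with
  | zero => exact fun i hi => ⟨lam, fun I hI => h.card_blocks_containing I (by omega)⟩
  | succ d ih =>
    intro i hi
    obtain ⟨c, hc⟩ := ih (i + 1) (by omega)
    have hsk := h.t_le_k
    have hv : Fintype.card α = v := by rw [← Nat.card_eq_fintype_card, h.card_points]
    refine ⟨(v - i) * c / (k - i), fun I hI => ?_⟩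
    have key : ∀ J : Finset α, {b ∈ B | J ⊆ b}.ncard = (B.toFinset.filter (J ⊆ ·)).card := by
      intro J
      rw [← Set.ncard_coe_finset]
      congr 1
      ext b
      simp
    rw [key]
    have hcount := Finset.sum_card_bipartiteAbove_eq_sum_card_bipartiteBelow
      (s := Iᶜ) (t := B.toFinset.filter (I ⊆ ·)) (r := fun x b => x ∈ b)
    have h1 : ∀ x ∈ Iᶜ, ((B.toFinset.filter (I ⊆ ·)).bipartiteAbove (fun x b => x ∈ b) x).card
        = c := by
      intro x hx
      rw [← hc (insert x I) (by rw [Finset.card_insert_of_notMem (by simpa using hx), hI]), key]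
      congr 1
      ext b
      simp only [Finset.mem_bipartiteAbove, Finset.mem_filter, Finset.insert_subset_iff]
      tauto
    have h2 : ∀ b ∈ B.toFinset.filter (I ⊆ ·),
        (Iᶜ.bipartiteBelow (fun x b => x ∈ b) b).card = k - i := by
      intro b hb
      rw [Finset.mem_filter, Set.mem_toFinset] at hb
      rw [← h.card_block b hb.1, ← hI, ← Finset.card_sdiff_of_subset hb.2]
      congr 1
      ext x
      simp only [Finset.mem_bipartiteBelow, Finset.mem_compl, Finset.mem_sdiff]
      tauto
    rw [Finset.sum_congr rfl h1, Finset.sum_congr rfl h2, Finset.sum_const, Finset.sum_const,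
      Finset.card_compl, hv, hI, smul_eq_mul, smul_eq_mul] at hcount
    rw [hcount, Nat.mul_div_cancel _ (by omega)]

/-- Inclusion-exclusion one point at a time: among the blocks containing `I` and avoiding `J`, those
avoiding a further point `x` are all except those containing `I ∪ {x}`. -/
lemma IsDesign.ncard_containing_disjoint_eq [Fintype α] [DecidableEq α]
    (h : IsDesign s v k lam B) (j : ℕ) :
    ∀ i, i + j ≤ s → ∃ c, ∀ I J : Finset α, I.card = i → J.card = j → Disjoint I J →
      {b ∈ B | I ⊆ b ∧ Disjoint J b}.ncard = c := by
  induction j with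
  | zero =>
    intro i hi
    obtain ⟨c, hc⟩ := h.ncard_containing_eq (s - i) i (by omega)
    refine ⟨c, fun I J hI hJ _ => ?_⟩
    rw [Finset.card_eq_zero.mp hJ, ← hc I hI]
    simp
  | succ j ih =>
    intro i hi
    obtain ⟨c₁, hc₁⟩ := ih i (by omega)
    obtain ⟨c₂, hc₂⟩ := ih (i + 1) (by omega)
    refine ⟨c₁ - c₂, fun I J hI hJ hIJ => ?_⟩
    obtain ⟨x, J, hx, rfl, hJ'⟩ := Finset.card_eq_succ.mp hJ
    rw [Finset.disjoint_insert_right] at hIJ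
    have e₁ := hc₁ I J hI hJ' hIJ.2
    have e₂ := hc₂ (insert x I) J (by rw [Finset.card_insert_of_notMem hIJ.1, hI]) hJ'
      (by rw [Finset.disjoint_insert_left]; exact ⟨hx, hIJ.2⟩)
    have e₃ : {b ∈ B | I ⊆ b ∧ Disjoint (insert x J) b} =
        {b ∈ B | I ⊆ b ∧ Disjoint J b} \ {b ∈ B | insert x I ⊆ b ∧ Disjoint J b} := by
      ext b
      simp only [Set.mem_ofPred_eq, Set.mem_sdiff, Finset.disjoint_insert_left,
        Finset.insert_subset_iff]
      tauto
    rw [e₃, Set.ncard_sdiff, e₁, e₂]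
    rintro b ⟨hb, hI, hJ⟩
    exact ⟨hb, (Finset.subset_insert _ _).trans hI, hJ⟩

/-- In a design with `v < s + k` all `k`-subsets are blocks. -/
lemma IsDesign.add_le_of_notMem [Finite α] (h : IsDesign s v k lam B) {T : Finset α}
    (hT : T.card = k) (hTB : T ∉ B) : s + k ≤ v := by
  classical
  have := Fintype.ofFinite α
  by_contra! hlt
  have hv : Fintype.card α = v := by rw [← Nat.card_eq_fintype_card, h.card_points]
  have hkv := h.k_le_v
  -- If `v - k < s`, the number of blocks avoiding a `(v - k)`-set is constant. The only `k`-set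
  -- avoiding the complement of a `k`-set `S` is `S` itself, so either all `k`-sets are blocks or
  -- none is; `lam_pos` excludes the latter.
  obtain ⟨c, hc⟩ := h.ncard_containing_disjoint_eq (v - k) 0 (by omega)
  have key : ∀ S : Finset α, S.card = k →
      {b ∈ B | ∅ ⊆ b ∧ Disjoint Sᶜ b} = {b | b ∈ B ∧ b = S} := by
    intro S hS
    ext b
    simp only [Set.mem_ofPred_eq, Finset.empty_subset, true_and]
    refine and_congr_right fun hb => ⟨fun hd => ?_, fun hd => hd ▸ disjoint_compl_left⟩
    refine Finset.eq_of_subset_of_card_le (fun x hx => ?_) (by rw [hS, h.card_block b hb])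
    by_contra hxS
    exact Finset.disjoint_left.mp hd (Finset.mem_compl.mpr hxS) hx
  have hcompl : ∀ S : Finset α, S.card = k → {b | b ∈ B ∧ b = S}.ncard = c := by
    intro S hS
    rw [← key S hS]
    exact hc ∅ Sᶜ rfl (by rw [Finset.card_compl, hv, hS]) (Finset.disjoint_empty_left _)
  obtain ⟨U, -, hU⟩ := Finset.exists_subset_card_eq (s := (Finset.univ : Finset α)) (n := s)
    (by rw [Finset.card_univ, hv]; exact h.t_le_k.trans hkv)
  have hpos := h.lam_pos
  rw [← h.card_blocks_containing U hU, Set.ncard_pos] at hpos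
  obtain ⟨b, hb, -⟩ := hpos
  have e₁ := hcompl b (h.card_block b hb)
  have e₂ := hcompl T hT
  rw [show {b | b ∈ B ∧ b = T} = ∅ by ext b; simp; rintro hb rfl; exact hTB hb,
    Set.ncard_empty] at e₂
  rw [show {b' | b' ∈ B ∧ b' = b} = {b} by ext b'; simp; rintro rfl; exact hb,
    Set.ncard_singleton] at e₁
  omega

/-- The complements of the blocks of an `s`-design form an `s`-design. -/
lemma IsDesign.exists_ncard_disjoint_eq [Finite α] (h : IsDesign s v k lam B) (hsk : s + k ≤ v) :
    ∃ c, 0 < c ∧ ∀ J : Finset α, J.card = s → {b ∈ B | Disjoint J b}.ncard = c := by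
  classical
  have := Fintype.ofFinite α
  have hv : Fintype.card α = v := by rw [← Nat.card_eq_fintype_card, h.card_points]
  obtain ⟨c, hc⟩ := h.ncard_containing_disjoint_eq s 0 (by omega)
  have hc' : ∀ J : Finset α, J.card = s → {b ∈ B | Disjoint J b}.ncard = c := fun J hJ => by
    simpa using hc ∅ J rfl hJ (Finset.disjoint_empty_left _)
  refine ⟨c, ?_, hc'⟩
  obtain ⟨U, -, hU⟩ := Finset.exists_subset_card_eq (s := (Finset.univ : Finset α)) (n := s)
    (by rw [Finset.card_univ, hv]; omega)
  have hpos := h.lam_pos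
  rw [← h.card_blocks_containing U hU, Set.ncard_pos] at hpos
  obtain ⟨b, hb, -⟩ := hpos
  obtain ⟨J, hJb, hJ⟩ := Finset.exists_subset_card_eq (s := bᶜ) (n := s)
    (by rw [Finset.card_compl, hv, h.card_block b hb]; omega)
  rw [← hc' J hJ, Set.ncard_pos]
  exact ⟨b, hb, Finset.disjoint_of_subset_left hJb disjoint_compl_left⟩

/-- Not all `k`-subsets of an abelian group sum to `x`. -/
lemma exists_notMem_subsetSumBlocks {G : Type*} [AddCommGroup G] [Finite G] {k : ℕ} (x : G)
    (hk : 0 < k) (hkG : k < Nat.card G) :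
    ∃ T : Finset G, T.card = k ∧ T ∉ subsetSumBlocks G k x := by
  classical
  have := Fintype.ofFinite G
  rw [Nat.card_eq_fintype_card] at hkG
  -- Deleting two different elements from the same `(k + 1)`-set gives two `k`-sets with different
  -- sums.
  obtain ⟨U, -, hU⟩ := Finset.exists_subset_card_eq (s := (Finset.univ : Finset G)) (n := k + 1)
    (by rw [Finset.card_univ]; omega)
  obtain ⟨a, ha, b, hb, hab⟩ := Finset.one_lt_card.mp (show 1 < U.card by omega)
  have hcard : ∀ g ∈ U, (U.erase g).card = k := fun g hg => by
    rw [Finset.card_erase_of_mem hg, hU]; rfl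
  by_contra! hall
  have h₁ := (hall _ (hcard a ha)).2
  have h₂ := (hall _ (hcard b hb)).2
  have e₁ := Finset.add_sum_erase U (fun g => g) ha
  have e₂ := Finset.add_sum_erase U (fun g => g) hb
  rw [h₁] at e₁
  rw [h₂, ← e₁] at e₂
  exact hab (add_right_cancel e₂).symm

end Designs

open WeierstrassCurve.Affine WeierstrassCurve.Affine.CoordinateRing

/-! ### Zeros of functions, norms and the class group -/

section CoordinateRing

universe u

variable {F : Type u} [Field F] {W : WeierstrassCurve.Affine F}

lemma eval₂_aeval_eq_aevalAeval {A : Type*} [CommRing A] [Algebra F A] (a b : A) (p : F[X][Y]) :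
    eval₂ (aeval a : F[X] →ₐ[F] A).toRingHom b p = aevalAeval a b p := by
  induction p using Polynomial.induction_on' with
  | add p q hp hq => rw [eval₂_add, map_add, hp, hq]
  | monomial n q =>
    rw [← C_mul_X_pow_eq_monomial, map_mul, map_pow, aevalAeval_C, aevalAeval_Y, eval₂_mul,
      eval₂_C, eval₂_X_pow]
    rfl

/-- Evaluation of the elements of the coordinate ring at a point with coordinates in `A`. -/
noncomputable def evalHom {A : Type*} [CommRing A] [Algebra F A] {a b : A}
    (h : aevalAeval a b W.polynomial = 0) : W.CoordinateRing →ₐ[F] A :=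
  { AdjoinRoot.lift (aeval a : F[X] →ₐ[F] A).toRingHom b
      ((eval₂_aeval_eq_aevalAeval a b _).trans h) with
    commutes' := fun c => by
      rw [IsScalarTower.algebraMap_apply F F[X] W.CoordinateRing]
      change AdjoinRoot.lift _ _ _ (AdjoinRoot.of _ _) = _
      rw [AdjoinRoot.lift_of]
      simp }

lemma evalHom_mk {A : Type*} [CommRing A] [Algebra F A] {a b : A}
    (h : aevalAeval a b W.polynomial = 0) (p : F[X][Y]) :
    evalHom h (mk W p) = aevalAeval a b p :=
  (AdjoinRoot.lift_mk ((eval₂_aeval_eq_aevalAeval a b _).trans h) _).trans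
    (eval₂_aeval_eq_aevalAeval a b p)

lemma aevalAeval_polynomial_eq_zero {x y : F} (h : W.Equation x y) :
    aevalAeval x y W.polynomial = 0 := by
  rw [coe_aevalAeval_eq_evalEval]
  exact h

/-- The value of an element of the coordinate ring at a rational point. -/
noncomputable abbrev valueAt {x y : F} (h : W.Nonsingular x y) : W.CoordinateRing →ₐ[F] F :=
  evalHom (aevalAeval_polynomial_eq_zero h.1)

lemma isMaximal_XYIdeal {x y : F} (h : W.Nonsingular x y) : (XYIdeal W x (C y)).IsMaximal :=
  Ideal.Quotient.maximal_of_isField _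
    ((quotientXYIdealEquiv (W' := W) (x := x) (y := C y) h.1).toMulEquiv.isField
      (Field.toIsField F))

lemma ker_valueAt {x y : F} (h : W.Nonsingular x y) :
    RingHom.ker (valueAt h) = XYIdeal W x (C y) := by
  refine ((isMaximal_XYIdeal h).eq_of_le (RingHom.ker_ne_top _) ?_).symm
  rw [XYIdeal, Ideal.span_le]
  rintro f (rfl | rfl)
  · rw [XClass, SetLike.mem_coe, RingHom.mem_ker, evalHom_mk]
    simp
  · rw [YClass, SetLike.mem_coe, RingHom.mem_ker, evalHom_mk]
    simp

lemma mem_XYIdeal {x y : F} (h : W.Nonsingular x y) {f : W.CoordinateRing} :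
    f ∈ XYIdeal W x (C y) ↔ valueAt h f = 0 := by
  rw [← ker_valueAt h, RingHom.mem_ker]

lemma isCoprime_XYIdeal {x₁ y₁ x₂ y₂ : F} (h₁ : W.Nonsingular x₁ y₁) (h₂ : W.Nonsingular x₂ y₂)
    (h : (x₁, y₁) ≠ (x₂, y₂)) : IsCoprime (XYIdeal W x₁ (C y₁)) (XYIdeal W x₂ (C y₂)) := by
  have := isMaximal_XYIdeal h₁
  have := isMaximal_XYIdeal h₂
  refine Ideal.isCoprime_of_isMaximal fun e => h ?_
  have hx : XClass W x₁ ∈ XYIdeal W x₂ (C y₂) := e ▸ Ideal.subset_span (by simp)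
  have hy : YClass W (C y₁) ∈ XYIdeal W x₂ (C y₂) := e ▸ Ideal.subset_span (by simp)
  rw [mem_XYIdeal h₂] at hx hy
  simp only [XClass, YClass, evalHom_mk, map_sub, aevalAeval_C, aevalAeval_Y, aeval_X, aeval_C,
    Algebra.algebraMap_self, RingHom.id_apply, sub_eq_zero] at hx hy
  rw [hx, hy]

/-- By Smith normal form over `F[X]` the quotient is a finite direct sum of rings `F[X]/(a)` with `a
≠ 0`. -/
lemma finiteDimensional_quotient_span {f : W.CoordinateRing} (hf : f ≠ 0) :
    FiniteDimensional F (W.CoordinateRing ⧸ Ideal.span {f}) := by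
  have hI := Ideal.span_singleton_eq_bot.not.2 hf
  exact Module.Finite.equiv
    (Ideal.quotientEquivDirectSum F (CoordinateRing.basis W) hI).symm

variable {ι : Type*} {x y : ι → F}

section Family

variable (h : ∀ i, W.Nonsingular (x i) (y i)) (hinj : Function.Injective fun i => (x i, y i))

include h hinj

lemma mem_prod_XYIdeal (S : Finset ι) {f : W.CoordinateRing} :
    f ∈ ∏ i ∈ S, XYIdeal W (x i) (C (y i)) ↔ ∀ i ∈ S, valueAt (h i) f = 0 := by
  rw [Ideal.prod_eq_iInf_of_pairwise_isCoprime]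
  · simp [mem_XYIdeal (h _)]
  · exact fun i _ j _ hij => isCoprime_XYIdeal (h i) (h j) (hinj.ne hij)

lemma exists_valueAt_eq (S : Finset ι) (c : S → F) :
    ∃ f : W.CoordinateRing, ∀ i : S, valueAt (h i) f = c i := by
  obtain ⟨f, hf⟩ := Ideal.exists_forall_sub_mem_ideal
    (I := fun i : S => XYIdeal W (x i) (C (y i)))
    (fun i j hij => isCoprime_XYIdeal (h i) (h j) (hinj.ne (Subtype.coe_injective.ne hij)))
    (fun i => algebraMap F _ (c i))
  refine ⟨f, fun i => ?_⟩
  have := (mem_XYIdeal (h i)).mp (hf i)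
  rwa [map_sub, AlgHom.commutes, sub_eq_zero] at this

/-- By the Chinese remainder theorem, evaluation on `S` is onto `F^S`; its kernel is the product
ideal. -/
lemma finrank_quotient_prod_XYIdeal (S : Finset ι) :
    Module.finrank F (W.CoordinateRing ⧸ ∏ i ∈ S, XYIdeal W (x i) (C (y i))) = S.card := by
  let ev : W.CoordinateRing →ₗ[F] (S → F) := LinearMap.pi fun i => (valueAt (h i)).toLinearMap
  have hev : Function.Surjective ev := fun c => by
    obtain ⟨f, hf⟩ := exists_valueAt_eq h hinj S c
    exact ⟨f, funext hf⟩
  have hker : LinearMap.ker ev = (∏ i ∈ S, XYIdeal W (x i) (C (y i))).restrictScalars F := by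
    ext f
    rw [Submodule.restrictScalars_mem, mem_prod_XYIdeal h hinj, LinearMap.mem_ker, funext_iff]
    simp [ev]
  rw [← Fintype.card_coe S, ← Module.finrank_fintype_fun_eq_card F,
    ← (ev.quotKerEquivOfSurjective hev).finrank_eq, hker]
  exact (Submodule.Quotient.restrictScalarsEquiv F _).finrank_eq.symm

/-- A nonzero function has at most as many zeros as the degree of its norm. -/
lemma card_le_natDegree_norm {S : Finset ι} {f : W.CoordinateRing} (hf : f ≠ 0)
    (hS : ∀ i ∈ S, valueAt (h i) f = 0) : S.card ≤ (Algebra.norm F[X] f).natDegree := by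
  have := finiteDimensional_quotient_span hf
  rw [← finrank_quotient_span_eq_natDegree_norm (F := F) (CoordinateRing.basis W) hf,
    ← finrank_quotient_prod_XYIdeal h hinj S]
  have hle : Ideal.span {f} ≤ ∏ i ∈ S, XYIdeal W (x i) (C (y i)) := by
    rw [Ideal.span_singleton_le_iff_mem]
    exact (mem_prod_XYIdeal h hinj S).mpr hS
  exact LinearMap.finrank_le_finrank_of_surjective (f := (Ideal.Quotient.factorₐ F hle).toLinearMap)
    (Ideal.Quotient.factor_surjective hle)

/-- The surjection from `R/(f)` to `R/∏` has source of dimension at most `|S|` and target of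
dimension `|S|`, so it is injective. -/
lemma prod_XYIdeal_eq_span {S : Finset ι} {f : W.CoordinateRing} (hf : f ≠ 0)
    (hS : ∀ i ∈ S, valueAt (h i) f = 0) (hdeg : (Algebra.norm F[X] f).natDegree ≤ S.card) :
    ∏ i ∈ S, XYIdeal W (x i) (C (y i)) = Ideal.span {f} := by
  have := finiteDimensional_quotient_span hf
  have hle : Ideal.span {f} ≤ ∏ i ∈ S, XYIdeal W (x i) (C (y i)) := by
    rw [Ideal.span_singleton_le_iff_mem]
    exact (mem_prod_XYIdeal h hinj S).mpr hS
  have hsurj : Function.Surjective (Ideal.Quotient.factorₐ F hle).toLinearMap :=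
    Ideal.Quotient.factor_surjective hle
  have : FiniteDimensional F (W.CoordinateRing ⧸ ∏ i ∈ S, XYIdeal W (x i) (C (y i))) :=
    Module.Finite.of_surjective _ hsurj
  have hrank : Module.finrank F (W.CoordinateRing ⧸ Ideal.span {f}) =
      Module.finrank F (W.CoordinateRing ⧸ ∏ i ∈ S, XYIdeal W (x i) (C (y i))) :=
    le_antisymm (by rwa [finrank_quotient_span_eq_natDegree_norm (F := F)
      (CoordinateRing.basis W) hf, finrank_quotient_prod_XYIdeal h hinj S])
      (LinearMap.finrank_le_finrank_of_surjective hsurj)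
  have hinj' := (LinearMap.injective_iff_surjective_of_finrank_eq_finrank hrank).mpr hsurj
  refine le_antisymm (fun g hg => ?_) hle
  rw [← Ideal.Quotient.eq_zero_iff_mem]
  exact hinj' ((Ideal.Quotient.eq_zero_iff_mem.mpr hg).trans (map_zero _).symm)

omit hinj

/-- The injective homomorphism `Point.toClass` sends a point to the class of its maximal ideal, and
a class is trivial iff the ideal is principal. -/
lemma sum_eq_zero_iff_exists_prod_eq_span [DecidableEq F] (S : Finset ι) :
    ∑ i ∈ S, Point.some (x i) (y i) (h i) = 0 ↔
      ∃ f : W.CoordinateRing, f ≠ 0 ∧ ∏ i ∈ S, XYIdeal W (x i) (C (y i)) = Ideal.span {f} := by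
  have hcoe : ((∏ i ∈ S, XYIdeal' (W := W) (h i) : (FractionalIdeal _ W.FunctionField)ˣ) :
      FractionalIdeal (nonZeroDivisors W.CoordinateRing) W.FunctionField) =
      ((∏ i ∈ S, XYIdeal W (x i) (C (y i)) : Ideal W.CoordinateRing) : FractionalIdeal _ _) := by
    rw [Units.coe_prod]
    exact (map_prod (FractionalIdeal.coeIdealHom (nonZeroDivisors W.CoordinateRing)
      W.FunctionField) _ S).symm
  rw [← ClassGroup.mk_eq_one_of_coe_ideal hcoe, ← Point.toClass_injective.eq_iff, map_sum,
    map_zero, map_prod]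
  rfl

/-- If a function of degree at most `|S|` vanishes on `S`, then the points of `S` sum to zero. -/
lemma sum_eq_zero_of_natDegree_norm_le [DecidableEq F]
    (hinj : Function.Injective fun i => (x i, y i)) {S : Finset ι} {f : W.CoordinateRing}
    (hf : f ≠ 0) (hS : ∀ i ∈ S, valueAt (h i) f = 0)
    (hdeg : (Algebra.norm F[X] f).natDegree ≤ S.card) :
    ∑ i ∈ S, Point.some (x i) (y i) (h i) = 0 :=
  (sum_eq_zero_iff_exists_prod_eq_span h S).mpr ⟨f, hf, prod_XYIdeal_eq_span h hinj hf hS hdeg⟩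

/-- If the points of `S` sum to zero, then some function of degree `|S|` vanishes on `S`. -/
lemma exists_natDegree_norm_eq [DecidableEq F] (hinj : Function.Injective fun i => (x i, y i))
    {S : Finset ι} (hS : ∑ i ∈ S, Point.some (x i) (y i) (h i) = 0) :
    ∃ f : W.CoordinateRing, f ≠ 0 ∧ (∀ i ∈ S, valueAt (h i) f = 0) ∧
      (Algebra.norm F[X] f).natDegree = S.card := by
  obtain ⟨f, hf, e⟩ := (sum_eq_zero_iff_exists_prod_eq_span h S).mp hS
  refine ⟨f, hf, ?_, ?_⟩
  · rw [← mem_prod_XYIdeal h hinj, e]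
    exact Ideal.mem_span_singleton_self f
  · rw [← finrank_quotient_span_eq_natDegree_norm (F := F) (CoordinateRing.basis W) hf, ← e,
      finrank_quotient_prod_XYIdeal h hinj]

end Family

end CoordinateRing

/-! ### The norm degree as pole order at infinity -/

section NormDegree

universe u

variable {F : Type u} [Field F] {W : WeierstrassCurve.Affine F}

/-- The ultrametric inequality for the pole order at `O`, read off from `max (2 deg p) (2 deg q +
3)`. -/
lemma degree_norm_add_le (f g : W.CoordinateRing) :
    (Algebra.norm F[X] (f + g)).degree ≤
      max (Algebra.norm F[X] f).degree (Algebra.norm F[X] g).degree := by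
  obtain ⟨p, q, rfl⟩ := exists_smul_basis_eq f
  obtain ⟨p', q', rfl⟩ := exists_smul_basis_eq g
  rw [add_add_add_comm, ← add_smul, ← add_smul, degree_norm_smul_basis, degree_norm_smul_basis,
    degree_norm_smul_basis]
  have hmono : Monotone fun d : WithBot ℕ => 2 • d := fun a b hab => nsmul_le_nsmul_right hab 2
  have hp : 2 • (p + p').degree ≤ max (2 • p.degree) (2 • p'.degree) :=
    (hmono (degree_add_le p p')).trans (hmono.map_max (a := p.degree)).le
  have hq : 2 • (q + q').degree ≤ max (2 • q.degree) (2 • q'.degree) :=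
    (hmono (degree_add_le q q')).trans (hmono.map_max (a := q.degree)).le
  refine max_le (hp.trans (max_le_max (le_max_left _ _) (le_max_left _ _))) ?_
  rcases le_max_iff.mp hq with h | h
  · exact le_max_of_le_left (le_max_of_le_right (by gcongr))
  · exact le_max_of_le_right (le_max_of_le_right (by gcongr))

/-- The coordinate function `x` in the coordinate ring. -/
noncomputable abbrev xElt (W : WeierstrassCurve.Affine F) : W.CoordinateRing := mk W (C X)

/-- The coordinate function `y` in the coordinate ring. -/
noncomputable abbrev yElt (W : WeierstrassCurve.Affine F) : W.CoordinateRing := mk W Y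

lemma degree_norm_xElt : (Algebra.norm F[X] (xElt W)).degree = 2 := by
  have := degree_norm_smul_basis (W' := W) X 0
  rw [zero_smul, add_zero, smul, mul_one] at this
  rw [this]
  simp

lemma degree_norm_yElt : (Algebra.norm F[X] (yElt W)).degree = 3 := by
  have := degree_norm_smul_basis (W' := W) 0 1
  rw [zero_smul, zero_add, one_smul] at this
  rw [this]
  simp

lemma degree_norm_algebraMap {c : F} (hc : c ≠ 0) :
    (Algebra.norm F[X] (algebraMap F W.CoordinateRing c)).degree = 0 := by
  have := degree_norm_smul_basis (W' := W) (C c) 0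
  rw [zero_smul, add_zero, smul, mul_one] at this
  refine Eq.trans ?_ (this.trans (by simp [degree_C hc]))
  rfl

lemma degree_norm_monomial {c : F} (hc : c ≠ 0) (i j : ℕ) :
    (Algebra.norm F[X] (algebraMap F W.CoordinateRing c * xElt W ^ i * yElt W ^ j)).degree =
      (2 * i + 3 * j : ℕ) := by
  rw [map_mul, map_mul, map_pow, map_pow, degree_mul, degree_mul, degree_pow, degree_pow,
    degree_norm_xElt, degree_norm_yElt, degree_norm_algebraMap hc, zero_add]
  simp [mul_comm]

lemma finite_coordinateRing : Module.Finite F[X] W.CoordinateRing :=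
  .of_basis (CoordinateRing.basis W)

lemma degree_norm_eq_bot {f : W.CoordinateRing} : (Algebra.norm F[X] f).degree = ⊥ ↔ f = 0 := by
  have := finite_coordinateRing (W := W)
  rw [degree_eq_bot, Algebra.norm_eq_zero_iff]

lemma xElt_ne_zero : xElt W ≠ 0 := fun h => by
  have := degree_norm_xElt (W := W)
  rw [degree_norm_eq_bot.mpr h] at this
  exact absurd this (by decide)

lemma yElt_ne_zero : yElt W ≠ 0 := fun h => by
  have := degree_norm_yElt (W := W)
  rw [degree_norm_eq_bot.mpr h] at this
  exact absurd this (by decide)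

end NormDegree

/-! ### Regularity and values at affine points -/

section AffineChart

universe u

variable {F : Type u} [Field F] {W : WeierstrassCurve.Affine F}

lemma algHom_eq_aevalAeval {A : Type*} [CommRing A] [Algebra F A] (φ : F[X][Y] →ₐ[F] A) :
    φ = aevalAeval (φ (C X)) (φ Y) :=
  ((aevalAevalEquiv F A).apply_symm_apply φ).symm

/-- The projection to the coordinate ring as an algebra homomorphism over the base field. -/
noncomputable def mkAlgHom (W : WeierstrassCurve.Affine F) : F[X][Y] →ₐ[F] W.CoordinateRing :=
  { mk W with commutes' := fun _ => rfl }

@[simp]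
lemma mkAlgHom_apply (p : F[X][Y]) : mkAlgHom W p = mk W p := rfl

lemma polyFun_some {a b : AlgebraicClosure F}
    (h : (WeierstrassCurve.map W (algebraMap F (AlgebraicClosure F))).toAffine.Nonsingular a b)
    (p : F[X][Y]) : polyFun (W := W) (.some a b h) p = algebraMap _ _ (mk W p) :=
  (DFunLike.congr_fun (algHom_eq_aevalAeval
    ((IsScalarTower.toAlgHom F W.CoordinateRing W.FunctionField).comp (mkAlgHom W))) p).symm

lemma aevalAeval_map {A B : Type*} [CommRing A] [Algebra F A] [CommRing B] [Algebra F B]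
    (φ : A →ₐ[F] B) (a b : A) (p : F[X][Y]) :
    aevalAeval (φ a) (φ b) p = φ (aevalAeval a b p) := by
  have := algHom_eq_aevalAeval (φ.comp (aevalAeval a b))
  simp only [AlgHom.comp_apply, aevalAeval_C, aevalAeval_Y, aeval_X] at this
  exact (DFunLike.congr_fun this p).symm

lemma aevalAeval_polynomial_geom {a b : AlgebraicClosure F} :
    (WeierstrassCurve.map W (algebraMap F (AlgebraicClosure F))).toAffine.Equation a b ↔
      aevalAeval a b W.polynomial = 0 := by
  rw [Equation, map_polynomial]
  simp [evalEval, aeval_def, eval₂_eq_eval_map]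

lemma polyVal_some {a b : AlgebraicClosure F}
    (h : (WeierstrassCurve.map W (algebraMap F (AlgebraicClosure F))).toAffine.Nonsingular a b)
    (p : F[X][Y]) :
    polyVal (W := W) (.some a b h) p = evalHom (aevalAeval_polynomial_geom.mp h.1) (mk W p) :=
  (evalHom_mk _ p).symm

lemma evalHom_eq {A : Type*} [CommRing A] [Algebra F A] (φ : W.CoordinateRing →ₐ[F] A) {a b : A}
    (h : aevalAeval a b W.polynomial = 0) (ha : φ (xElt W) = a) (hb : φ (yElt W) = b)
    (f : W.CoordinateRing) : evalHom h f = φ f := by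
  obtain ⟨p, rfl⟩ := AdjoinRoot.mk_surjective f
  rw [evalHom_mk]
  subst ha hb
  exact (DFunLike.congr_fun (algHom_eq_aevalAeval (φ.comp (mkAlgHom W))) p).symm

/-- Every maximal ideal of the coordinate ring is the ideal of a geometric point. -/
lemma exists_ker_eq_of_isMaximal (M : Ideal W.CoordinateRing) [M.IsMaximal] :
    ∃ φ : W.CoordinateRing →ₐ[F] AlgebraicClosure F, ∀ f ∈ M, φ f = 0 := by
  let := Ideal.Quotient.field M
  have := finite_coordinateRing (W := W)
  have : Algebra.FiniteType F W.CoordinateRing :=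
    Algebra.FiniteType.trans (S := F[X]) inferInstance inferInstance
  have : Algebra.FiniteType F (W.CoordinateRing ⧸ M) := inferInstance
  -- Zariski's lemma: the residue field is finite over `F`, hence embeds into the algebraic closure.
  have : Module.Finite F (W.CoordinateRing ⧸ M) := finite_of_finite_type_of_isJacobsonRing _ _
  refine ⟨(IsAlgClosed.lift : (W.CoordinateRing ⧸ M) →ₐ[F] AlgebraicClosure F).comp
    (Ideal.Quotient.mkₐ F M), fun f hf => ?_⟩
  rw [AlgHom.comp_apply, Ideal.Quotient.mkₐ_eq_mk, Ideal.Quotient.eq_zero_iff_mem.mpr hf, map_zero]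

lemma valGE_zero_iff {Q : GeomPoint W} {f : W.FunctionField} : ValGE Q 0 f ↔ f ∈ localRing Q := by
  constructor
  · intro h
    obtain ⟨r, -, hr⟩ := h 1 (by simp)
    rw [OneMemClass.coe_one, mul_one] at hr
    rw [hr]
    exact r.2
  · intro h g _
    exact ⟨⟨f, h⟩ * g, by simp, rfl⟩

lemma algebraMap_mem_localRing {a b : AlgebraicClosure F}
    (h : (WeierstrassCurve.map W (algebraMap F (AlgebraicClosure F))).toAffine.Nonsingular a b)
    (r : W.CoordinateRing) : algebraMap _ W.FunctionField r ∈ localRing (W := W) (.some a b h) := by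
  obtain ⟨p, rfl⟩ := AdjoinRoot.mk_surjective r
  exact ⟨p, 1, by rw [map_one]; exact one_ne_zero, by rw [map_one, mul_one, polyFun_some]⟩

/-- A rational function that is regular at all affine geometric points is in the coordinate
ring. -/
lemma exists_algebraMap_eq [W.IsElliptic] {f : W.FunctionField}
    (hf : ∀ Q : GeomPoint W, Q ≠ 0 → f ∈ localRing Q) :
    ∃ r : W.CoordinateRing, algebraMap _ _ r = f := by
  -- `J` is the ideal of denominators of `f`. If it were proper, it would vanish at some geometric
  -- point `Q`, but regularity of `f` at `Q` provides a denominator in `J` that is nonzero at `Q`.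
  let J : Ideal W.CoordinateRing :=
    { carrier := {r | ∃ s, f * algebraMap _ _ r = algebraMap W.CoordinateRing _ s}
      zero_mem' := ⟨0, by simp⟩
      add_mem' := by
        rintro _ _ ⟨s, hs⟩ ⟨t, ht⟩
        exact ⟨s + t, by rw [map_add, map_add, mul_add, hs, ht]⟩
      smul_mem' := by
        rintro c r ⟨s, hs⟩
        exact ⟨c * s, by rw [smul_eq_mul, map_mul, map_mul, mul_left_comm, hs]⟩ }
  suffices hJ : J = ⊤ by
    obtain ⟨s, hs⟩ : (1 : W.CoordinateRing) ∈ J := hJ ▸ Submodule.mem_top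
    exact ⟨s, by rw [← hs, map_one, mul_one]⟩
  by_contra hJ
  obtain ⟨M, hM, hJM⟩ := Ideal.exists_le_maximal J hJ
  obtain ⟨φ, hφ⟩ := exists_ker_eq_of_isMaximal M
  have heq : (WeierstrassCurve.map W (algebraMap F (AlgebraicClosure F))).toAffine.Equation
      (φ (xElt W)) (φ (yElt W)) := by
    rw [aevalAeval_polynomial_geom]
    have := DFunLike.congr_fun (algHom_eq_aevalAeval (φ.comp (mkAlgHom W))) W.polynomial
    rw [AlgHom.comp_apply, mkAlgHom_apply, mk, AdjoinRoot.mk_self, map_zero] at this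
    exact this.symm
  have hns := (equation_iff_nonsingular
    (W := (WeierstrassCurve.map W (algebraMap F (AlgebraicClosure F))).toAffine)).mp heq
  obtain ⟨g, h, hval, he⟩ := hf (.some _ _ hns) (Point.some_ne_zero hns)
  rw [polyVal_some, evalHom_eq φ _ rfl rfl] at hval
  rw [polyFun_some, polyFun_some] at he
  exact hval (hφ _ (hJM ⟨_, he⟩))

lemma polyVal_toGeom_some {a b : F} (h : W.Nonsingular a b) (p : F[X][Y]) :
    polyVal (toGeom W (.some a b h)) p = algebraMap F (AlgebraicClosure F) (valueAt h (mk W p)) := by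
  rw [evalHom_mk]
  exact aevalAeval_map (Algebra.ofId F (AlgebraicClosure F)) a b p

lemma hasValue_algebraMap_iff {a b : F} (h : W.Nonsingular a b) {r : W.CoordinateRing} {c : F} :
    HasValue (algebraMap _ W.FunctionField r) (.some a b h) c ↔ valueAt h r = c := by
  constructor
  · rintro ⟨g, d, ⟨hd, he⟩, hv⟩
    rw [polyVal_toGeom_some] at hd
    rw [polyVal_toGeom_some, polyVal_toGeom_some, ← map_mul] at hv
    have hv := (algebraMap F (AlgebraicClosure F)).injective hv
    rw [toGeom, polyFun_some, polyFun_some, ← map_mul] at he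
    have he := IsFractionRing.injective W.CoordinateRing W.FunctionField he
    rw [← he, map_mul] at hv
    exact (mul_right_cancel₀ (fun h0 => hd (by rw [h0, map_zero])) hv).symm
  · rintro rfl
    obtain ⟨p, rfl⟩ := AdjoinRoot.mk_surjective r
    refine ⟨p, 1, ⟨by rw [map_one]; exact one_ne_zero, ?_⟩, ?_⟩
    · rw [map_one, mul_one, toGeom, polyFun_some]
    · rw [map_one, mul_one, polyVal_toGeom_some]

end AffineChart

/-! ### The local ring at infinity and the Riemann–Roch space of `kO` -/

section InfinityChart

universe u

variable {F : Type u} [Field F] {W : WeierstrassCurve.Affine F}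

lemma xFun_eq : xFun W = algebraMap _ _ (xElt W) := rfl

lemma yFun_eq : yFun W = algebraMap _ _ (yElt W) := rfl

lemma xFun_ne_zero : xFun W ≠ 0 :=
  (map_ne_zero_iff _ (IsFractionRing.injective W.CoordinateRing W.FunctionField)).mpr xElt_ne_zero

lemma yFun_ne_zero : yFun W ≠ 0 :=
  (map_ne_zero_iff _ (IsFractionRing.injective W.CoordinateRing W.FunctionField)).mpr yElt_ne_zero

lemma polyVal_zero (p : F[X][Y]) :
    polyVal (0 : GeomPoint W) p = algebraMap F (AlgebraicClosure F) ((p.coeff 0).coeff 0) := by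
  have := aevalAeval_map (Algebra.ofId F (AlgebraicClosure F)) 0 0 p
  rw [map_zero] at this
  refine this.trans ?_
  rw [coe_aevalAeval_eq_evalEval, evalEval, C_0, ← coeff_zero_eq_eval_zero,
    ← coeff_zero_eq_eval_zero]
  rfl

lemma polyVal_zero_ne_zero {p : F[X][Y]} :
    polyVal (0 : GeomPoint W) p ≠ 0 ↔ (p.coeff 0).coeff 0 ≠ 0 := by
  rw [polyVal_zero, Ne, map_eq_zero]

lemma polyFun_zero_CX : polyFun (0 : GeomPoint W) (C X) = xFun W / yFun W := aevalAeval_X _ _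

lemma polyFun_zero_Y : polyFun (0 : GeomPoint W) Y = 1 / yFun W := aevalAeval_Y _ _

lemma polyFun_zero_CC (c : F) : polyFun (0 : GeomPoint W) (C (C c)) = algebraMap F _ c :=
  (polyFun (0 : GeomPoint W)).commutes c

variable (W) in
/-- The polynomial `p` in `x / y` and `1 / y`, multiplied by a large power `y ^ m`, is `c y ^ m`
plus a function with a pole at infinity of order smaller than `3 m`, where `c` is the constant
coefficient of `p`. -/
def HasLeadingTerm (p : F[X][Y]) : Prop :=
  ∃ m₀ : ℕ, ∀ m ≥ m₀, ∃ r : W.CoordinateRing,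
    algebraMap _ _ (r + algebraMap F _ ((p.coeff 0).coeff 0) * yElt W ^ m) =
      yFun W ^ m * polyFun (0 : GeomPoint W) p ∧
    (Algebra.norm F[X] r).degree < (3 * m : ℕ)

lemma HasLeadingTerm.add {p q : F[X][Y]} (hp : HasLeadingTerm W p) (hq : HasLeadingTerm W q) :
    HasLeadingTerm W (p + q) := by
  obtain ⟨m₁, h₁⟩ := hp
  obtain ⟨m₂, h₂⟩ := hq
  refine ⟨max m₁ m₂, fun m hm => ?_⟩
  obtain ⟨r, hr, hr'⟩ := h₁ m (le_trans (le_max_left _ _) hm)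
  obtain ⟨s, hs, hs'⟩ := h₂ m (le_trans (le_max_right _ _) hm)
  refine ⟨r + s, ?_, (degree_norm_add_le r s).trans_lt (max_lt hr' hs')⟩
  rw [map_add (polyFun _), mul_add, ← hr, ← hs, ← map_add]
  congr 1
  rw [coeff_add, coeff_add, map_add]
  ring

lemma hasLeadingTerm_monomial (i j : ℕ) (c : F) :
    HasLeadingTerm W (monomial j (monomial i c)) := by
  -- For `m = i + j + l`, `y^m (x/y)^i (1/y)^j = x^i y^l` has degree `2i + 3l`, which is below `3m`
  -- unless `i = j = 0`.
  refine ⟨i + j, fun m hm => ?_⟩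
  obtain ⟨l, rfl⟩ := Nat.exists_eq_add_of_le hm
  have hfun : polyFun (0 : GeomPoint W) (monomial j (monomial i c)) =
      algebraMap F _ c * (xFun W / yFun W) ^ i * (1 / yFun W) ^ j := by
    rw [← C_mul_X_pow_eq_monomial, ← C_mul_X_pow_eq_monomial, C_mul, C_pow, map_mul, map_mul,
      map_pow, map_pow, polyFun_zero_CX, polyFun_zero_Y, polyFun_zero_CC]
  have hc (d : F) : algebraMap W.CoordinateRing W.FunctionField (algebraMap F _ d) =
      algebraMap F _ d := (IsScalarTower.algebraMap_apply F _ _ d).symm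
  have hy := yFun_ne_zero (W := W)
  rw [hfun]
  by_cases hij : i = 0 ∧ j = 0
  · obtain ⟨rfl, rfl⟩ := hij
    refine ⟨0, ?_, ?_⟩
    · simp only [monomial_zero_left, coeff_C_zero, zero_add, map_mul, map_pow, hc, pow_zero,
        mul_one, yFun_eq]
      ring
    · rw [degree_norm_eq_bot.mpr rfl]
      exact WithBot.bot_lt_coe _
  · refine ⟨algebraMap F _ c * xElt W ^ i * yElt W ^ l, ?_, ?_⟩
    · have h0 : ((monomial j (monomial i c) : F[X][Y]).coeff 0).coeff 0 = 0 := by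
        rw [coeff_monomial]
        split_ifs with h
        · rw [coeff_monomial, if_neg (fun h' => hij ⟨h', h⟩)]
        · rfl
      rw [h0, map_zero, zero_mul, add_zero, map_mul, map_mul, map_pow, map_pow, hc, ← xFun_eq,
        ← yFun_eq]
      rw [div_pow, div_pow, one_pow, pow_add, pow_add]
      field_simp
    · by_cases hc0 : c = 0
      · rw [degree_norm_eq_bot.mpr (by rw [hc0, map_zero, zero_mul, zero_mul])]
        exact WithBot.bot_lt_coe _
      · rw [degree_norm_monomial hc0]
        exact Nat.cast_lt.mpr (by omega)

lemma hasLeadingTerm (p : F[X][Y]) : HasLeadingTerm W p := by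
  induction p using Polynomial.induction_on' with
  | add p q hp hq => exact hp.add hq
  | monomial j q =>
    induction q using Polynomial.induction_on' with
    | add p q hp hq => rw [map_add]; exact hp.add hq
    | monomial i c => exact hasLeadingTerm_monomial i j c

lemma degree_norm_add_mul_pow_le {m : ℕ} {r : W.CoordinateRing}
    (hr : (Algebra.norm F[X] r).degree < (3 * m : ℕ)) (c : F) :
    (Algebra.norm F[X] (r + algebraMap F _ c * yElt W ^ m)).degree ≤ (3 * m : ℕ) := by
  refine (degree_norm_add_le _ _).trans (max_le hr.le ?_)
  by_cases hc : c = 0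
  · rw [degree_norm_eq_bot.mpr (by rw [hc, map_zero, zero_mul])]
    exact bot_le
  · simpa using (degree_norm_monomial (W := W) hc 0 m).le

lemma le_degree_norm_add_mul_pow {m : ℕ} {r : W.CoordinateRing}
    (hr : (Algebra.norm F[X] r).degree < (3 * m : ℕ)) {c : F} (hc : c ≠ 0) :
    (3 * m : ℕ) ≤ (Algebra.norm F[X] (r + algebraMap F _ c * yElt W ^ m)).degree := by
  have h := degree_norm_add_le (r + algebraMap F _ c * yElt W ^ m) (-r)
  have h0 := degree_norm_monomial (W := W) hc 0 m
  have hneg : (Algebra.norm F[X] (-r)).degree = (Algebra.norm F[X] r).degree := by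
    obtain ⟨p, q, rfl⟩ := exists_smul_basis_eq r
    rw [neg_add, ← neg_smul, ← neg_smul, degree_norm_smul_basis, degree_norm_smul_basis,
      degree_neg, degree_neg]
  rw [pow_zero, mul_one, mul_zero, zero_add] at h0
  rw [add_neg_cancel_comm, h0, hneg] at h
  exact (le_max_iff.mp h).resolve_right hr.not_ge

lemma polyFun_zero_ne_zero {p : F[X][Y]} (hp : polyVal (0 : GeomPoint W) p ≠ 0) :
    polyFun (0 : GeomPoint W) p ≠ 0 := fun h => by
  obtain ⟨m, hm⟩ := hasLeadingTerm (W := W) p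
  obtain ⟨r, hr, hdeg⟩ := hm m le_rfl
  rw [h, mul_zero, map_eq_zero_iff _ (IsFractionRing.injective W.CoordinateRing _)] at hr
  have := le_degree_norm_add_mul_pow hdeg (polyVal_zero_ne_zero.mp hp)
  rw [degree_norm_eq_bot.mpr hr, le_bot_iff] at this
  exact WithBot.coe_ne_bot this

/-- The local parameter `x / y` at infinity, as an element of the local ring. -/
noncomputable def unifZero (W : WeierstrassCurve.Affine F) : localRing (0 : GeomPoint W) :=
  ⟨xFun W / yFun W, C X, 1, by rw [map_one]; exact one_ne_zero, by
    rw [map_one, mul_one, polyFun_zero_CX]⟩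

lemma unifZero_mem_maxIdeal : unifZero W ∈ maxIdeal (0 : GeomPoint W) :=
  ⟨C X, 1, ⟨by rw [map_one]; exact one_ne_zero, by
    rw [map_one, mul_one, polyFun_zero_CX, unifZero]⟩, by rw [polyVal_zero]; simp⟩

variable (W) in
/-- The function `x ^ 3 / y ^ 2` in terms of the coordinates `x / y` and `1 / y`. -/
noncomputable def unitPoly : F[X][Y] :=
  1 + C (C W.a₁) * C X + C (C W.a₃) * Y - C (C W.a₂) * C X ^ 2 - C (C W.a₄) * C X * Y -
    C (C W.a₆) * Y ^ 2

/-- This is the Weierstrass equation divided by `y²`. As `unitPoly` has constant coefficient `1`,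
`x³/y²` is a unit at `O`. -/
lemma polyFun_unitPoly : polyFun (0 : GeomPoint W) (unitPoly W) = xFun W ^ 3 / yFun W ^ 2 := by
  have hy := yFun_ne_zero (W := W)
  have heq : yFun W ^ 2 + algebraMap F _ W.a₁ * xFun W * yFun W + algebraMap F _ W.a₃ * yFun W =
      xFun W ^ 3 + algebraMap F _ W.a₂ * xFun W ^ 2 + algebraMap F _ W.a₄ * xFun W +
        algebraMap F _ W.a₆ := by
    have h : aevalAeval (xFun W) (yFun W) W.polynomial = 0 := by
      have := aevalAeval_map (IsScalarTower.toAlgHom F W.CoordinateRing W.FunctionField)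
        (xElt W) (yElt W) W.polynomial
      refine this.trans ((congr_arg _ ?_).trans (map_zero _))
      exact (DFunLike.congr_fun (algHom_eq_aevalAeval (mkAlgHom W)) W.polynomial).symm.trans
        AdjoinRoot.mk_self
    simp only [WeierstrassCurve.Affine.polynomial, map_add, map_sub, map_mul, map_pow,
      aevalAeval_C, aevalAeval_Y, aeval_X, aeval_C] at h
    linear_combination h
  simp only [unitPoly, map_add, map_sub, map_mul, map_pow, map_one, polyFun_zero_CX,
    polyFun_zero_Y, polyFun_zero_CC]
  field_simp
  linear_combination heq

lemma coeff_unitPoly : ((unitPoly W).coeff 0).coeff 0 = 1 := by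
  simp [unitPoly, mul_coeff_zero, pow_two]

/-- With `z = x/y`, `w = 1/y` and the unit `u = x³/y²` one has `w u = z³`, so `z` alone generates
the maximal ideal. -/
lemma maxIdeal_zero_le : maxIdeal (0 : GeomPoint W) ≤ Ideal.span {unifZero W} := by
  rintro ⟨e, he⟩ ⟨g, d, ⟨hd, hed⟩, hg⟩
  rw [polyVal_zero, map_eq_zero] at hg
  have hx := xFun_ne_zero (W := W)
  have hy := yFun_ne_zero (W := W)
  have hdfun := polyFun_zero_ne_zero hd
  have hdec : g = Y * g.divX + C X * C (g.coeff 0).divX := by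
    conv_lhs => rw [← divX_mul_X_add g, ← divX_mul_X_add (g.coeff 0), hg]
    simp only [map_add, map_mul, map_zero]
    ring
  rw [Ideal.mem_span_singleton']
  -- Writing `g = w g₁ + z g₂` and substituting `w = z³/u` gives `g/d = z (z² g₁ + u g₂)/(d u)`.
  refine ⟨⟨(polyFun (0 : GeomPoint W) g.divX * (xFun W / yFun W) ^ 2 +
    polyFun (0 : GeomPoint W) (C (g.coeff 0).divX * unitPoly W)) /
      polyFun (0 : GeomPoint W) (d * unitPoly W),
    g.divX * C X ^ 2 + C (g.coeff 0).divX * unitPoly W, d * unitPoly W, ?_, ?_⟩, ?_⟩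
  · rw [polyVal_zero_ne_zero] at hd ⊢
    rwa [mul_coeff_zero, mul_coeff_zero, coeff_unitPoly, mul_one]
  · rw [div_mul_cancel₀, map_add, map_mul, map_mul, map_pow, polyFun_zero_CX]
    rw [map_mul, polyFun_unitPoly]
    positivity
  · ext
    rw [Subring.coe_mul, unifZero]
    simp only
    rw [hdec, map_add, map_mul, map_mul, polyFun_zero_Y, polyFun_zero_CX] at hed
    rw [map_mul, map_mul, polyFun_unitPoly]
    field_simp at hed ⊢
    linear_combination -hed

/-- The bounds are `2 deg p ≤ k` and `2 deg q + 3 ≤ k`. For `k ≤ 2` the truncated `(k - 1) / 2` is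
`0`, which forces `q = 0`. -/
lemma natDegree_norm_smul_basis_le_iff {p q : F[X]} {k : ℕ} :
    (Algebra.norm F[X] (p • (1 : W.CoordinateRing) + q • mk W Y)).natDegree ≤ k ↔
      p ∈ degreeLT F (k / 2 + 1) ∧ q ∈ degreeLT F ((k - 1) / 2) := by
  have hp : 2 • p.degree ≤ (k : WithBot ℕ) ↔ p.degree < (k / 2 + 1 : ℕ) := by
    by_cases h : p = 0
    · simp [h]
    · rw [degree_eq_natDegree h, nsmul_eq_mul, Nat.cast_lt]
      norm_cast
      omega
  have hq : 2 • q.degree + 3 ≤ (k : WithBot ℕ) ↔ q.degree < ((k - 1) / 2 : ℕ) := by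
    by_cases h : q = 0
    · simp [h]
    · rw [degree_eq_natDegree h, nsmul_eq_mul, Nat.cast_lt]
      norm_cast
      omega
  rw [natDegree_le_iff_degree_le, degree_norm_smul_basis, max_le_iff, hp, hq, mem_degreeLT,
    mem_degreeLT]

lemma mem_localRing_unitPoly : xFun W ^ 3 / yFun W ^ 2 ∈ localRing (0 : GeomPoint W) :=
  ⟨unitPoly W, 1, by rw [map_one]; exact one_ne_zero, by rw [map_one, mul_one, polyFun_unitPoly]⟩

lemma aeval_xFun_mul_pow_mem_localRing {p : F[X]} {k : ℕ} (hp : 2 * p.natDegree ≤ k) :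
    aeval (xFun W) p * (unifZero W : W.FunctionField) ^ k ∈ localRing (0 : GeomPoint W) := by
  have hy := yFun_ne_zero (W := W)
  rw [aeval_eq_sum_range, Finset.sum_mul]
  refine sum_mem fun i hi => ?_
  obtain ⟨l, rfl⟩ := Nat.exists_eq_add_of_le
    (show 2 * i ≤ k by have := Finset.mem_range.mp hi; omega)
  have e : p.coeff i • xFun W ^ i * (unifZero W : W.FunctionField) ^ (2 * i + l) =
      algebraMap F _ (p.coeff i) * (xFun W ^ 3 / yFun W ^ 2) ^ i * (unifZero W : _) ^ l := by
    have hw : xFun W ^ 3 / yFun W ^ 2 = xFun W * (xFun W / yFun W) ^ 2 := by field_simp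
    rw [hw, Algebra.smul_def, pow_add, pow_mul, unifZero]
    ring
  rw [e]
  exact mul_mem (mul_mem ⟨_, _, isFractionAt_algebraMap _ _⟩ (pow_mem mem_localRing_unitPoly i))
    (pow_mem (unifZero W).2 l)

lemma algebraMap_smul_basis (p q : F[X]) :
    algebraMap _ W.FunctionField (p • (1 : W.CoordinateRing) + q • mk W Y) =
      aeval (xFun W) p + aeval (xFun W) q * yFun W := by
  have h (p : F[X]) : algebraMap _ W.FunctionField (mk W (C p)) = aeval (xFun W) p := by
    have := DFunLike.congr_fun (algHom_eq_aevalAeval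
      ((IsScalarTower.toAlgHom F W.CoordinateRing W.FunctionField).comp (mkAlgHom W))) (C p)
    exact this.trans (aevalAeval_C _ _ p)
  rw [smul, smul, mul_one, map_add, map_mul, h, h, yFun_eq]

/-- Elements of the coordinate ring with a pole of order at most `k` at infinity. -/
lemma valGE_zero_iff_natDegree_norm_le {r : W.CoordinateRing} {k : ℕ} :
    ValGE (0 : GeomPoint W) (-(k : ℤ)) (algebraMap _ _ r) ↔
      (Algebra.norm F[X] r).natDegree ≤ k := by
  have hx := xFun_ne_zero (W := W)
  have hy := yFun_ne_zero (W := W)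
  rw [ValGE, neg_neg, Int.toNat_natCast, Int.toNat_neg_natCast, pow_zero]
  constructor
  · intro h
    by_cases hr0 : r = 0
    · have := finite_coordinateRing (W := W)
      simp [hr0]
    obtain ⟨⟨_, a, b, hb, hab⟩, -, rfl⟩ :=
      h (unifZero W ^ k) (Ideal.pow_mem_pow unifZero_mem_maxIdeal k)
    obtain ⟨m₁, h₁⟩ := hasLeadingTerm (W := W) a
    obtain ⟨m₂, h₂⟩ := hasLeadingTerm (W := W) b
    obtain ⟨A, hA, hA'⟩ := h₁ (max m₁ m₂) (le_max_left _ _)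
    obtain ⟨B, hB, hB'⟩ := h₂ (max m₁ m₂) (le_max_right _ _)
    replace hA' := degree_norm_add_mul_pow_le hA' ((a.coeff 0).coeff 0)
    replace hB' := le_degree_norm_add_mul_pow hB' (polyVal_zero_ne_zero.mp hb)
    set m := max m₁ m₂
    set A' := A + algebraMap F _ ((a.coeff 0).coeff 0) * yElt W ^ m
    set B' := B + algebraMap F _ ((b.coeff 0).coeff 0) * yElt W ^ m
    -- With `r (x/y)^k = a/b` and `b(O) ≠ 0`, clear denominators by `y^(m + k)`. Comparing degrees,
    -- `deg r + 2k + 3m ≤ 3k + 3m`, so `deg r ≤ k`.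
    have he : r * xElt W ^ k * B' = yElt W ^ k * A' := by
      apply IsFractionRing.injective W.CoordinateRing W.FunctionField
      simp only [map_mul, map_pow, hA, hB, ← xFun_eq, ← yFun_eq, ← hab, unifZero, Subring.coe_pow,
        div_pow]
      field_simp
    have hd := congr_arg (fun f => (Algebra.norm F[X] f).degree) he
    simp only [map_mul, map_pow, degree_mul, degree_pow, degree_norm_xElt, degree_norm_yElt] at hd
    have hr : (Algebra.norm F[X] r).degree ≠ ⊥ := by rwa [Ne, degree_norm_eq_bot]
    rw [degree_eq_natDegree (degree_eq_bot.not.mp hr)] at hd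
    have hB0 : (Algebra.norm F[X] B').degree ≠ ⊥ := by
      intro h0
      rw [h0] at hB'
      exact WithBot.coe_ne_bot (le_bot_iff.mp hB')
    rw [degree_eq_natDegree (degree_eq_bot.not.mp hB0)] at hd hB'
    have hle := hd.le.trans (add_le_add_right hA' _)
    simp only [nsmul_eq_mul] at hle
    norm_cast at hle hB'
    omega
  · intro h g hg
    have hg := Ideal.pow_right_mono maxIdeal_zero_le k hg
    rw [Ideal.span_singleton_pow, Ideal.mem_span_singleton'] at hg
    obtain ⟨c, rfl⟩ := hg
    suffices hmem : algebraMap _ _ r * (unifZero W : W.FunctionField) ^ k ∈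
        localRing (0 : GeomPoint W) from
      ⟨c * ⟨_, hmem⟩, by simp, by
        rw [Subring.coe_mul, Subring.coe_mul, Subring.coe_pow]; ring⟩
    -- Since `x z² = y z³ = x³/y²` is regular at `O`, a factor `z^k` cancels the poles of `p(x)` and
    -- `q(x) y`.
    obtain ⟨p, q, rfl⟩ := exists_smul_basis_eq r
    obtain ⟨hp, hq⟩ := natDegree_norm_smul_basis_le_iff.mp h
    rw [mem_degreeLT] at hp hq
    rw [algebraMap_smul_basis, add_mul]
    refine add_mem (aeval_xFun_mul_pow_mem_localRing ?_) ?_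
    · by_cases hp0 : p = 0
      · simp [hp0]
      · rw [degree_eq_natDegree hp0, Nat.cast_lt] at hp
        omega
    · by_cases hq0 : q = 0
      · rw [hq0, map_zero, zero_mul, zero_mul]
        exact zero_mem _
      · rw [degree_eq_natDegree hq0, Nat.cast_lt] at hq
        obtain ⟨l, rfl⟩ := Nat.exists_eq_add_of_le (show 3 ≤ k by omega)
        have e : aeval (xFun W) q * yFun W * (unifZero W : W.FunctionField) ^ (3 + l) =
            aeval (xFun W) q * (unifZero W : _) ^ l * (xFun W ^ 3 / yFun W ^ 2) := by
          rw [pow_add, unifZero]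
          simp only
          field_simp
        rw [e]
        exact mul_mem (aeval_xFun_mul_pow_mem_localRing (by omega)) mem_localRing_unitPoly

/-- The Riemann–Roch space of `k O` consists of the elements of the coordinate ring with a pole of
order at most `k` at infinity. -/
lemma mem_riemannRochSpace_single_iff [W.IsElliptic] {k : ℕ} {f : W.FunctionField} :
    f ∈ riemannRochSpace (Finsupp.single (0 : GeomPoint W) (k : ℤ)) ↔
      ∃ r : W.CoordinateRing, algebraMap _ _ r = f ∧ (Algebra.norm F[X] r).natDegree ≤ k := by
  constructor
  · intro h
    obtain ⟨r, rfl⟩ := exists_algebraMap_eq (f := f) fun Q hQ => by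
      have := h Q
      rwa [Finsupp.single_eq_of_ne hQ, neg_zero, valGE_zero_iff] at this
    refine ⟨r, rfl, ?_⟩
    have := h 0
    rwa [Finsupp.single_eq_same, valGE_zero_iff_natDegree_norm_le] at this
  · rintro ⟨r, rfl, hr⟩ Q
    by_cases hQ : Q = 0
    · rwa [hQ, Finsupp.single_eq_same, valGE_zero_iff_natDegree_norm_le]
    · rw [Finsupp.single_eq_of_ne hQ, neg_zero, valGE_zero_iff]
      rcases Q with _ | ⟨a, b, h⟩
      · exact (hQ rfl).elim
      · exact algebraMap_mem_localRing h r

end InfinityChart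

/-! ### Dimension, distance and minimum-weight supports of the code -/

section OnePointCode

universe u

variable {F : Type u} [Field F] {W : WeierstrassCurve.Affine F} {n k : ℕ} {x y : Fin n → F}
  (h : ∀ i, W.Nonsingular (x i) (y i))

lemma mem_agCode_single_iff [W.IsElliptic] {c : Fin n → F} :
    c ∈ agCode (fun i => Point.some (x i) (y i) (h i)) (Finsupp.single (0 : GeomPoint W) (k : ℤ)) ↔
      ∃ r : W.CoordinateRing, (Algebra.norm F[X] r).natDegree ≤ k ∧
        ∀ i, valueAt (h i) r = c i := by
  constructor
  · rintro ⟨f, hf, hc⟩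
    obtain ⟨r, rfl, hr⟩ := mem_riemannRochSpace_single_iff.mp hf
    exact ⟨r, hr, fun i => (hasValue_algebraMap_iff (h i)).mp (hc i)⟩
  · rintro ⟨r, hr, hc⟩
    exact ⟨algebraMap _ _ r, mem_riemannRochSpace_single_iff.mpr ⟨r, rfl, hr⟩,
      fun i => (hasValue_algebraMap_iff (h i)).mpr (hc i)⟩

/-- The encoding map of the code of `k O`, in terms of the coefficients of `1` and `y`. -/
noncomputable def encode (k : ℕ) :
    (degreeLT F (k / 2 + 1) × degreeLT F ((k - 1) / 2)) →ₗ[F] (Fin n → F) where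
  toFun pq i := valueAt (h i) ((pq.1 : F[X]) • (1 : W.CoordinateRing) + (pq.2 : F[X]) • mk W Y)
  map_add' pq pq' := by
    ext i
    simp only [Prod.fst_add, Prod.snd_add, Submodule.coe_add, add_smul, map_add, Pi.add_apply]
    ring
  map_smul' c pq := by
    ext i
    simp only [Prod.smul_fst, Prod.smul_snd, Submodule.coe_smul, smul_assoc, map_add, map_smul,
      RingHom.id_apply, Pi.smul_apply, smul_add]

lemma range_encode [W.IsElliptic] :
    LinearMap.range (encode h k) = agCode (fun i => Point.some (x i) (y i) (h i))
      (Finsupp.single (0 : GeomPoint W) (k : ℤ)) := by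
  ext c
  rw [mem_agCode_single_iff, LinearMap.mem_range]
  constructor
  · rintro ⟨⟨⟨p, hp⟩, ⟨q, hq⟩⟩, rfl⟩
    exact ⟨_, natDegree_norm_smul_basis_le_iff.mpr ⟨hp, hq⟩, fun i => rfl⟩
  · rintro ⟨r, hr, hc⟩
    obtain ⟨p, q, rfl⟩ := exists_smul_basis_eq r
    obtain ⟨hp, hq⟩ := natDegree_norm_smul_basis_le_iff.mp hr
    exact ⟨⟨⟨p, hp⟩, ⟨q, hq⟩⟩, funext hc⟩

variable (hinj : Function.Injective fun i => (x i, y i))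

include hinj in
lemma encode_injective (hkn : k < n) : Function.Injective (encode h k) := by
  rw [injective_iff_map_eq_zero]
  rintro ⟨⟨p, hp⟩, ⟨q, hq⟩⟩ hpq
  have hdeg := natDegree_norm_smul_basis_le_iff (W := W).mpr ⟨hp, hq⟩
  by_cases hr : p • (1 : W.CoordinateRing) + q • mk W Y = 0
  · obtain ⟨rfl, rfl⟩ := smul_basis_eq_zero hr
    rfl
  · have := card_le_natDegree_norm h hinj (S := Finset.univ) hr fun i _ => congr_fun hpq i
    rw [Finset.card_univ, Fintype.card_fin] at this
    omega

include hinj in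
lemma finrank_agCode_single [W.IsElliptic] (hk : 1 ≤ k) (hkn : k < n) :
    Module.finrank F (agCode (fun i => Point.some (x i) (y i) (h i))
      (Finsupp.single (0 : GeomPoint W) (k : ℤ))) = k := by
  rw [← range_encode, LinearMap.finrank_range_of_inj (encode_injective h hinj hkn)]
  have := Module.Finite.equiv (degreeLTEquiv F (k / 2 + 1)).symm
  have := Module.Finite.equiv (degreeLTEquiv F ((k - 1) / 2)).symm
  rw [Module.finrank_prod, (degreeLTEquiv F _).finrank_eq, (degreeLTEquiv F _).finrank_eq,
    Module.finrank_fin_fun, Module.finrank_fin_fun]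
  -- For `k ≥ 1`, `(k / 2 + 1) + (k - 1) / 2 = k`.
  omega

variable [DecidableEq F]

lemma card_wordSupport (c : Fin n → F) : (wordSupport c).card = hammingNorm c := rfl

lemma card_compl_wordSupport (c : Fin n → F) : (wordSupport c)ᶜ.card = n - hammingNorm c := by
  rw [Finset.card_compl, Fintype.card_fin, card_wordSupport]

lemma mem_compl_wordSupport {c : Fin n → F} {i : Fin n} : i ∈ (wordSupport c)ᶜ ↔ c i = 0 := by
  simp [wordSupport]

lemma hammingNorm_le_length (c : Fin n → F) : hammingNorm c ≤ n := by
  simpa using hammingNorm_le_card_fintype (x := c)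

include hinj in
/-- The minimum distance of the code of `k O` is at least `n - k`. -/
lemma le_hammingNorm_of_mem_agCode [W.IsElliptic] {c : Fin n → F}
    (hc : c ∈ agCode (fun i => Point.some (x i) (y i) (h i))
      (Finsupp.single (0 : GeomPoint W) (k : ℤ))) (hc0 : c ≠ 0) : n - k ≤ hammingNorm c := by
  obtain ⟨r, hr, hrc⟩ := (mem_agCode_single_iff h).mp hc
  have hr0 : r ≠ 0 := by
    rintro rfl
    exact hc0 (funext fun i => by rw [← hrc i, map_zero]; rfl)
  have := card_le_natDegree_norm h hinj (S := (wordSupport c)ᶜ) hr0 fun i hi => by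
    rw [hrc, mem_compl_wordSupport.mp hi]
  rw [card_compl_wordSupport] at this
  omega

include hinj in
/-- The supports of the codewords of weight `n - k` are the complements of the sets of `k` points
with sum zero. -/
lemma mem_weightSupports_agCode_iff [W.IsElliptic] (hkn : k < n) {S : Finset (Fin n)} :
    S ∈ weightSupports (agCode (fun i => Point.some (x i) (y i) (h i))
      (Finsupp.single (0 : GeomPoint W) (k : ℤ))) (n - k) ↔
      Sᶜ.card = k ∧ ∑ i ∈ Sᶜ, Point.some (x i) (y i) (h i) = 0 := by
  constructor
  · rintro ⟨c, hc, hw, rfl⟩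
    obtain ⟨r, hr, hrc⟩ := (mem_agCode_single_iff h).mp hc
    have hcard : (wordSupport c)ᶜ.card = k := by
      rw [card_compl_wordSupport, hw]
      omega
    refine ⟨hcard, sum_eq_zero_of_natDegree_norm_le h hinj (f := r) ?_ (fun i hi => ?_)
      (hr.trans hcard.ge)⟩
    · rintro rfl
      have : c = 0 := funext fun i => by rw [← hrc i, map_zero]; rfl
      rw [this, hammingNorm_zero] at hw
      omega
    · rw [hrc, mem_compl_wordSupport.mp hi]
  · rintro ⟨hcard, hsum⟩
    obtain ⟨f, hf, hfS, hdeg⟩ := exists_natDegree_norm_eq h hinj hsum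
    let c : Fin n → F := fun i => valueAt (h i) f
    have hle := card_le_natDegree_norm h hinj (S := (wordSupport c)ᶜ) hf fun i hi =>
      mem_compl_wordSupport.mp hi
    -- `f` has degree `k = |Sᶜ|`, so it has no zeros among the points beyond those in `Sᶜ`.
    have hsupp : Sᶜ = (wordSupport c)ᶜ := Finset.eq_of_subset_of_card_le
      (fun i hi => mem_compl_wordSupport.mpr (hfS i hi)) (hle.trans hdeg.le)
    refine ⟨c, (mem_agCode_single_iff h).mpr ⟨f, (hdeg.trans hcard).le, fun i => rfl⟩, ?_,
      (compl_injective hsupp).symm⟩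
    rw [hsupp, card_compl_wordSupport] at hcard
    have := hammingNorm_le_length c
    omega

end OnePointCode

/-! ### From zero-sum blocks to complements among the nonzero elements -/

section DerivedDesign

/-- Complementing inside the nonzero elements turns the `k`-subsets with sum zero that avoid zero
and `T` into the blocks containing `T`. -/
lemma ncard_containing_eq_ncard_disjoint {ι G : Type*} [Fintype ι] [DecidableEq ι]
    [AddCommGroup G] [DecidableEq G] (e : ι ↪ G) (he : Set.range e = {g | g ≠ 0}) (k : ℕ)
    (T : Finset ι) :
    {S : Finset ι | (Sᶜ.card = k ∧ ∑ i ∈ Sᶜ, e i = 0) ∧ T ⊆ S}.ncard =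
      {b ∈ subsetSumBlocks G k 0 | Disjoint (insert 0 (T.map e)) b}.ncard := by
  have hinj : Function.Injective fun S : Finset ι => Sᶜ.map e :=
    (Finset.map_injective e).comp compl_injective
  rw [← Set.ncard_image_of_injective _ hinj]
  congr 1
  ext b
  constructor
  · rintro ⟨S, ⟨⟨hcard, hsum⟩, hT⟩, rfl⟩
    refine ⟨⟨by rw [Finset.card_map, hcard], by rw [Finset.sum_map, hsum]⟩, ?_⟩
    rw [Finset.disjoint_insert_left, Finset.disjoint_map]
    refine ⟨fun h0 => ?_, Finset.disjoint_of_subset_left hT disjoint_compl_right⟩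
    obtain ⟨i, -, hi⟩ := Finset.mem_map.mp h0
    exact (he.subset ⟨i, rfl⟩ : e i ≠ 0) hi
  · rintro ⟨⟨hcard, hsum⟩, hdisj⟩
    rw [Finset.disjoint_insert_left] at hdisj
    have hb : (Finset.univ.filter (e · ∈ b)).map e = b := by
      ext g
      simp only [Finset.mem_map, Finset.mem_filter, Finset.mem_univ, true_and]
      constructor
      · rintro ⟨i, hi, rfl⟩
        exact hi
      · intro hg
        obtain ⟨i, rfl⟩ := he.superset (show g ≠ 0 by rintro rfl; exact hdisj.1 hg)
        exact ⟨i, hg, rfl⟩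
    refine ⟨(Finset.univ.filter (e · ∈ b))ᶜ, ⟨⟨?_, ?_⟩, fun i hi => ?_⟩, ?_⟩
    · rw [compl_compl, ← Finset.card_map e, hb, hcard]
    · rw [compl_compl, ← Finset.sum_map _ e fun g => g, hb, hsum]
    · rw [Finset.mem_compl, Finset.mem_filter]
      exact fun hib => Finset.disjoint_left.mp hdisj.2 (Finset.mem_map_of_mem e hi) hib.2
    · simp only [compl_compl, hb]

/-- If the zero-sum `k`-subsets form a `(t + 1)`-design, then the complements, among the nonzero
elements, of those that avoid zero form a `t`-design. -/
lemma exists_isDesign_compl {G : Type*} [AddCommGroup G] {n k t lam : ℕ} (e : Fin n ↪ G)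
    (he : Set.range e = {g | g ≠ 0}) (hk : 1 ≤ k) (hkn : k < n)
    (hD : IsDesign (t + 1) (n + 1) k lam (subsetSumBlocks G k 0)) :
    ∃ mu : ℕ, IsDesign t n (n - k) mu
      {S : Finset (Fin n) | Sᶜ.card = k ∧ ∑ i ∈ Sᶜ, e i = 0} := by
  classical
  have := hD.finite_points
  -- A `k`-set with nonzero sum yields `t + 1 + k ≤ n + 1`, that is `t ≤ n - k`.
  obtain ⟨U, hU, hUB⟩ := exists_notMem_subsetSumBlocks (0 : G) hk
    (by rw [hD.card_points]; omega)
  have hle := hD.add_le_of_notMem hU hUB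
  obtain ⟨mu, hmu, hJ⟩ := hD.exists_ncard_disjoint_eq hle
  refine ⟨mu, Nat.card_fin n, inferInstance, by omega, Nat.sub_le _ _, hmu, ?_, fun T hT => ?_⟩
  · rintro S ⟨hS, -⟩
    rw [Finset.card_compl, Fintype.card_fin] at hS
    have := S.card_le_univ
    rw [Fintype.card_fin] at this
    omega
  · refine (ncard_containing_eq_ncard_disjoint e he k T).trans (hJ _ ?_)
    rw [Finset.card_insert_of_notMem, Finset.card_map, hT]
    intro h0
    obtain ⟨i, -, hi⟩ := Finset.mem_map.mp h0
    exact (he.subset ⟨i, rfl⟩ : e i ≠ 0) hi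

end DerivedDesign

lemma exists_eq_some {F : Type*} [Field F] {W : WeierstrassCurve.Affine F} {n : ℕ}
    {P : Fin n → W.Point} (hP : ∀ i, P i ≠ 0) :
    ∃ (x y : Fin n → F) (h : ∀ i, W.Nonsingular (x i) (y i)),
      P = fun i => .some (x i) (y i) (h i) := by
  have (i : Fin n) : ∃ (a b : F) (h : W.Nonsingular a b), P i = .some a b h := by
    rcases hi : P i with _ | ⟨a, b, h⟩
    · exact (hP i hi).elim
    · exact ⟨a, b, h, rfl⟩
  choose x y h e using this
  exact ⟨x, y, h, funext e⟩

end EllipticCode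

theorem theorem6p3 {F : Type*} [Field F] [Finite F] [DecidableEq F]
    (E : WeierstrassCurve F) [E.IsElliptic]
    (n₁ n₂ n k t : ℕ) (hn₁ : 1 < n₁) (hn₁₂ : n₁ ∣ n₂) (hn : n = n₁ * n₂ - 1)
    (iso : E.toAffine.Point ≃+ ZMod n₁ × ZMod n₂)
    (P : Fin n → E.toAffine.Point) (hP : Function.Injective P)
    (hPrange : Set.range P = {Q | Q ≠ 0})
    (hk : 1 ≤ k) (hkn : k ≤ n - 1) (ht : 1 ≤ t) (hn₂k : n₂ ∣ k)
    (hdesign : ∃ lam : ℕ, EllipticCode.IsDesign (t + 1) (n + 1) k lam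
      (EllipticCode.subsetSumBlocks (ZMod n₁ × ZMod n₂) k 0)) :
    let C := EllipticCode.agCode P (Finsupp.single (0 : EllipticCode.GeomPoint E) (k : ℤ))
    Module.finrank F C = k ∧
    EllipticCode.IsMinDistance C (n - k) ∧
    ∃ lam : ℕ, EllipticCode.IsDesign t n (n - k) lam (EllipticCode.weightSupports C (n - k)) := by
  have hP0 : ∀ i, P i ≠ 0 := fun i => hPrange.subset ⟨i, rfl⟩
  obtain ⟨x, y, h, rfl⟩ := EllipticCode.exists_eq_some hP0
  intro C
  have hkn' : k < n := by omega
  obtain ⟨lam, hD⟩ := hdesign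
  let e : Fin n ↪ ZMod n₁ × ZMod n₂ :=
    ⟨fun i => iso (.some (x i) (y i) (h i)), iso.injective.comp hP⟩
  have he : Set.range e = {g | g ≠ 0} := by
    ext g
    have hg : iso.symm g ∈ Set.range (fun i => .some (x i) (y i) (h i)) ↔
        iso.symm g ≠ 0 := by rw [hPrange]; rfl
    rw [Set.mem_ofPred_eq, ← iso.symm.map_ne_zero_iff, ← hg]
    simp [e, AddEquiv.eq_symm_apply]
  have hinj : Function.Injective fun i => (x i, y i) := by
    intro i j hij
    rw [Prod.mk.injEq] at hij
    exact hP ((WeierstrassCurve.Affine.Point.some.injEq ..).mpr hij)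
  have hW : EllipticCode.weightSupports C (n - k) =
      {S : Finset (Fin n) | Sᶜ.card = k ∧ ∑ i ∈ Sᶜ, e i = 0} := by
    ext S
    have hsum : ∑ i ∈ Sᶜ, e i = iso (∑ i ∈ Sᶜ, .some (x i) (y i) (h i)) := (map_sum iso _ _).symm
    rw [Set.mem_ofPred_eq, hsum, map_eq_zero_iff _ iso.injective]
    exact EllipticCode.mem_weightSupports_agCode_iff h hinj hkn'
  obtain ⟨mu, hdes⟩ := EllipticCode.exists_isDesign_compl e he hk hkn' hD
  rw [← hW] at hdes
  refine ⟨?_, ⟨?_, ?_⟩, mu, hdes⟩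
  · exact EllipticCode.finrank_agCode_single h hinj hk hkn'
  -- The design has positive index, so some block, and with it a word of weight `n - k > 0`, exists.
  · obtain ⟨T, -, hT⟩ := Finset.exists_subset_card_eq (s := (Finset.univ : Finset (Fin n))) (n := t)
      (by rw [Finset.card_univ, Fintype.card_fin]; exact hdes.t_le_k.trans hdes.k_le_v)
    have hpos := hdes.lam_pos
    rw [← hdes.card_blocks_containing T hT, Set.ncard_pos] at hpos
    obtain ⟨_, ⟨c, hc, hw, -⟩, -⟩ := hpos
    refine ⟨c, hc, ?_, hw⟩
    rintro rfl
    rw [hammingNorm_zero] at hw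
    omega
  · rintro _ ⟨c, hc, hc0, rfl⟩
    exact EllipticCode.le_hammingNorm_of_mem_agCode h hinj hc hc0
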